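/- Let $P$ be a real affine space of finite dimension $n\ge 3$ with space of translations $V$, and let $F:TP=P\times V\to[0,\infty)$ be a $C^2$ Finsler metric, that is, a continuous function which is $C^2$ outside the zero section and whose restriction to every tangent space is a Minkowski norm. Here a Minkowski norm is a (possibly asymmetric) function $N:V\to[0,\infty)$ that is $C^2$ outside the origin, vanishes only at $\mathbf 0$, satisfies $N(\lambda v)=\lambda N(v)$ for $\lambda>0$ and $N(v+w)\le N(v)+N(w)$, and is such that the Hessian of $N^2$ is positive definite outside the origin. A $C^2$ Finsler metric on an affine space is called Minkowski--Randers if it is the sum of a translation-invariant Finsler metric and a differential $1$-form (the $1$-form is then necessarily of class $C^2$). Then $F$ is Minkowski--Randers if and only if for some integer $k$ with $2\le k\le n-1$ the set of $k$-planes (that is, $k$-dimensional affine subspaces) $Y\subset P$ for which the metric induced by $F$ on $Y$ is Minkowski--Randers is dense in the affine Grassmannian ${\rm Graff}_k(P)$ of all $k$-planes, with its usual topology. -/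

import Mathlib

/-!
Finsler metrics on finite-dimensional real affine spaces.  The affine space is a type `P` that is a
torsor over a finite-dimensional normed space `V`; its tangent bundle is `P × V`, and a function on
the tangent bundle is written `F : P → V → ℝ`.  The norm of `V` only serves to express the (norm
independent) topology and differentiability classes.
-/

/-- A (possibly asymmetric) Minkowski norm on a finite-dimensional real vector space. -/
structure IsMinkowskiNorm {V : Type*} [NormedAddCommGroup V] [NormedSpace ℝ V]
    (N : V → ℝ) : Prop where
  nonneg : ∀ v, 0 ≤ N v
  contDiffOn : ContDiffOn ℝ 2 N {v | v ≠ 0}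
  eq_zero_iff : ∀ v, N v = 0 ↔ v = 0
  pos_homogeneous : ∀ (c : ℝ) (v : V), 0 < c → N (c • v) = c * N v
  triangle : ∀ v w, N (v + w) ≤ N v + N w
  /-- the Hessian of the square of the norm is positive definite outside the origin -/
  hessian_pos : ∀ v w : V, v ≠ 0 → w ≠ 0 →
    0 < fderiv ℝ (fderiv ℝ (fun u => N u ^ 2)) v w w

/-- A `C²` Finsler metric on the affine space `P`: a continuous function on the tangent bundle that
is `C²` outside the zero section and restricts to a Minkowski norm on every tangent space. -/
structure IsFinslerMetric {V P : Type*} [NormedAddCommGroup V] [NormedSpace ℝ V]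
    [MetricSpace P] [NormedAddTorsor V P] (F : P → V → ℝ) : Prop where
  continuous : Continuous fun q : P × V => F q.1 q.2
  /-- `C²` outside the zero section, in the affine chart with origin `o` -/
  contDiffOn : ∀ o : P, ContDiffOn ℝ 2 (fun q : V × V => F (q.1 +ᵥ o) q.2) {q | q.2 ≠ 0}
  isMinkowskiNorm : ∀ x : P, IsMinkowskiNorm (F x)

/-- A differential `1`-form of class `C²` on the affine space `P`. -/
def IsC2OneForm {V P : Type*} [NormedAddCommGroup V] [NormedSpace ℝ V]
    [MetricSpace P] [NormedAddTorsor V P] (β : P → V →L[ℝ] ℝ) : Prop :=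
  ∀ o : P, ContDiff ℝ 2 (fun w : V => β (w +ᵥ o))

/-- The affine space `P` with the function `F` on its tangent bundle is a Minkowski-Randers space:
`F` is a `C²` Finsler metric that is the sum of a translation-invariant Finsler metric and a
`1`-form.  (The difference of two `C²` Finsler metrics is `C²` outside the zero section, so the
regularity asked of the `1`-form is automatic.) -/
def IsMinkowskiRanders {V P : Type*} [NormedAddCommGroup V] [NormedSpace ℝ V]
    [MetricSpace P] [NormedAddTorsor V P] (F : P → V → ℝ) : Prop :=
  IsFinslerMetric F ∧
    ∃ (F₀ : P → V → ℝ) (β : P → V →L[ℝ] ℝ),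
      IsFinslerMetric F₀ ∧ (∀ (w : V) (x : P) (v : V), F₀ (w +ᵥ x) v = F₀ x v) ∧
      IsC2OneForm β ∧ ∀ (x : P) (v : V), F x v = F₀ x v + β x v

/-- The metric induced on an affine subspace `Y`, whose tangent bundle is `Y × Y.direction`. -/
def inducedMetric {V P : Type*} [NormedAddCommGroup V] [NormedSpace ℝ V]
    [MetricSpace P] [NormedAddTorsor V P] (F : P → V → ℝ) (Y : AffineSubspace ℝ P) :
    Y → Y.direction → ℝ :=
  fun x v => F x v

/-- The affine Grassmannian of `k`-planes, i.e. `k`-dimensional affine subspaces, of `P`. -/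
def Graff (k : ℕ) (V P : Type*) [NormedAddCommGroup V] [NormedSpace ℝ V]
    [MetricSpace P] [NormedAddTorsor V P] : Type _ :=
  {Y : AffineSubspace ℝ P // (Y : Set P).Nonempty ∧ Module.finrank ℝ Y.direction = k}

instance Graff.instNonempty {k : ℕ} {V P : Type*} [NormedAddCommGroup V] [NormedSpace ℝ V]
    [MetricSpace P] [NormedAddTorsor V P] (Y : Graff k V P) : Nonempty Y.1 :=
  Y.2.1.to_subtype

/-- The `k`-plane spanned by `k + 1` affinely independent points. -/
def Graff.span {k : ℕ} {V P : Type*} [NormedAddCommGroup V] [NormedSpace ℝ V]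
    [MetricSpace P] [NormedAddTorsor V P]
    (p : {p : Fin (k + 1) → P // AffineIndependent ℝ p}) : Graff k V P :=
  ⟨affineSpan ℝ (Set.range p.1), (affineSpan_nonempty ℝ).2 (Set.range_nonempty _), by
    rw [direction_affineSpan]
    exact p.2.finrank_vectorSpan (Fintype.card_fin _)⟩

/-- The usual topology of the affine Grassmannian: the quotient topology of the space of affinely
independent `(k + 1)`-tuples of points (an open subset of `P ^ (k + 1)`). -/
instance Graff.instTopologicalSpace {k : ℕ} {V P : Type*} [NormedAddCommGroup V]
    [NormedSpace ℝ V] [MetricSpace P] [NormedAddTorsor V P] : TopologicalSpace (Graff k V P) :=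
  TopologicalSpace.coinduced Graff.span inferInstance

/-! The additivity defect `F x (v + w) - F x v - F x w` does not see 1-forms, so `F` is
Minkowski-Randers exactly when the defect is independent of `x`. For a fixed Finsler metric,
constancy of the defect along a `k`-plane is a closed condition on the plane. If it holds on a dense
set it therefore holds on every `k`-plane, and, since `k ≥ 2`, along every 2-plane.

To pass from planes to `P`, let `B u v` be the derivative of `F · v` in the direction `u` at a
point. It is linear in `u`, and constancy on planes makes `B u` additive on pairs of vectors
coplanar with `u`. This already forces the parallelogram law for `z ↦ B z z`, whose polarization `B
u v + B v u` is then biadditive. Removing the term `B v u`, additive in `v`, shows that `B u` is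
additive. So the derivative of the defect vanishes along every line. -/

open Module

/-! ### Restriction to affine subspaces -/

section Restriction

variable {V P : Type*} [NormedAddCommGroup V] [NormedSpace ℝ V]
  [MetricSpace P] [NormedAddTorsor V P]

theorem IsMinkowskiNorm.restrict {N : V → ℝ} (hN : IsMinkowskiNorm N) (W : Submodule ℝ V) :
    IsMinkowskiNorm fun v : W => N v where
  nonneg v := hN.nonneg v
  contDiffOn := hN.contDiffOn.comp W.subtypeL.contDiff.contDiffOn fun v hv => by
    simpa using hv
  eq_zero_iff v := by simp [hN.eq_zero_iff]
  pos_homogeneous c v hc := hN.pos_homogeneous c v hc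
  triangle v w := hN.triangle v w
  hessian_pos v w hv hw := by
    set f : V → ℝ := fun u => N u ^ 2 with hf
    have hopen : IsOpen {u : V | u ≠ 0} := isOpen_ne
    have hfC : ContDiffOn ℝ 2 f {u | u ≠ 0} := hN.contDiffOn.pow 2
    have hv' : (v : V) ≠ 0 := by simpa using hv
    have hw' : (w : V) ≠ 0 := by simpa using hw
    have hdiff : ∀ u : V, u ≠ 0 → DifferentiableAt ℝ f u := fun u hu =>
      (hfC.contDiffAt (hopen.mem_nhds hu)).differentiableAt (by norm_num)
    have hdiff₂ : DifferentiableAt ℝ (fderiv ℝ f) (v : V) :=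
      ((hfC.contDiffAt (hopen.mem_nhds hv')).fderiv_right (m := 1) (by norm_num)).differentiableAt
        (by norm_num)
    -- Restriction of functionals to `W` is a fixed continuous linear map, so it commutes with the
    -- second differentiation.
    have hfirst : (fderiv ℝ fun u : W => N u ^ 2) =ᶠ[nhds v]
        fun u => (ContinuousLinearMap.compL ℝ W V ℝ).flip W.subtypeL (fderiv ℝ f (u : V)) := by
      filter_upwards [isOpen_ne.mem_nhds hv] with u hu
      have hu' : (u : V) ≠ 0 := by simpa using hu
      exact ((hdiff u hu').hasFDerivAt.comp u W.subtypeL.hasFDerivAt).fderiv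
    have hsecond : HasFDerivAt
        (fun u : W => (ContinuousLinearMap.compL ℝ W V ℝ).flip W.subtypeL (fderiv ℝ f (u : V)))
        (((ContinuousLinearMap.compL ℝ W V ℝ).flip W.subtypeL).comp
          ((fderiv ℝ (fderiv ℝ f) v).comp W.subtypeL)) v :=
      ((ContinuousLinearMap.compL ℝ W V ℝ).flip W.subtypeL).hasFDerivAt.comp v
        (hdiff₂.hasFDerivAt.comp v W.subtypeL.hasFDerivAt)
    rw [hfirst.fderiv_eq, hsecond.fderiv]
    exact hN.hessian_pos v w hv' hw'

theorem IsFinslerMetric.inducedMetric {F : P → V → ℝ} (hF : IsFinslerMetric F)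
    (Y : AffineSubspace ℝ P) [Nonempty Y] : IsFinslerMetric (inducedMetric F Y) where
  continuous := hF.continuous.comp
    ((continuous_subtype_val.comp continuous_fst).prodMk
      (continuous_subtype_val.comp continuous_snd))
  contDiffOn o := (hF.contDiffOn (o : P)).comp
    (Y.direction.subtypeL.prodMap Y.direction.subtypeL).contDiff.contDiffOn fun q hq => by
      simpa using hq
  isMinkowskiNorm x := (hF.isMinkowskiNorm x).restrict Y.direction

theorem IsMinkowskiRanders.inducedMetric {F : P → V → ℝ} (hF : IsMinkowskiRanders F)
    (Y : AffineSubspace ℝ P) [Nonempty Y] : IsMinkowskiRanders (inducedMetric F Y) := by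
  obtain ⟨hFF, F₀, β, hF₀, hinv, hβ, hsum⟩ := hF
  refine ⟨hFF.inducedMetric Y, _root_.inducedMetric F₀ Y,
    fun x => (β x).comp Y.direction.subtypeL, hF₀.inducedMetric Y,
    fun w x v => hinv w x v, fun o => ?_, fun x v => hsum x v⟩
  exact ((ContinuousLinearMap.compL ℝ Y.direction V ℝ).flip
    Y.direction.subtypeL).contDiff.comp ((hβ (o : P)).comp Y.direction.subtypeL.contDiff)

end Restriction

/-! ### Independence of the defect from the point characterizes Minkowski-Randers metrics -/

section Additivity

variable {V P : Type*} [NormedAddCommGroup V] [NormedSpace ℝ V]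
  [MetricSpace P] [NormedAddTorsor V P]

/-- The failure of additivity of a function `N` at a pair of vectors. -/
def additivityDefect (N : V → ℝ) (v w : V) : ℝ := N (v + w) - N v - N w

theorem IsMinkowskiRanders.additivityDefect_eq {F : P → V → ℝ} (hF : IsMinkowskiRanders F)
    (x y : P) (v w : V) : additivityDefect (F x) v w = additivityDefect (F y) v w := by
  obtain ⟨-, F₀, β, -, hinv, -, hsum⟩ := hF
  have h : ∀ u, F₀ y u = F₀ x u := fun u => by simpa using hinv (y -ᵥ x) x u
  simp only [additivityDefect, hsum, h, map_add]
  ring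

theorem IsMinkowskiNorm.map_zero {N : V → ℝ} (hN : IsMinkowskiNorm N) : N 0 = 0 :=
  (hN.eq_zero_iff 0).2 rfl

/-- Two Minkowski norms with the same additivity defect differ by a linear form. -/
def IsMinkowskiNorm.subLinear {N M : V → ℝ} (hN : IsMinkowskiNorm N) (hM : IsMinkowskiNorm M)
    (h : ∀ v w, additivityDefect N v w = additivityDefect M v w) : V →ₗ[ℝ] ℝ where
  toFun v := N v - M v
  map_add' v w := by
    have := h v w
    simp only [additivityDefect] at this
    linarith
  map_smul' c v := by
    -- The defects at `(u, -u)` show that the difference is odd, which extends homogeneity to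
    -- negative scalars.
    have hneg : ∀ u, N (-u) - M (-u) = -(N u - M u) := fun u => by
      have := h u (-u)
      simp only [additivityDefect, add_neg_cancel, hN.map_zero, hM.map_zero] at this
      linarith
    simp only [RingHom.id_apply, smul_eq_mul]
    rcases lt_trichotomy c 0 with hc | rfl | hc
    · have hc' : c • v = -((-c) • v) := by simp
      rw [hc', hneg, hN.pos_homogeneous _ _ (neg_pos.2 hc), hM.pos_homogeneous _ _ (neg_pos.2 hc)]
      ring
    · simp [hN.map_zero, hM.map_zero]
    · rw [hN.pos_homogeneous _ _ hc, hM.pos_homogeneous _ _ hc]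
      ring

theorem IsFinslerMetric.contDiff_left {F : P → V → ℝ} (hF : IsFinslerMetric F) (o : P) (v : V) :
    ContDiff ℝ 2 fun w : V => F (w +ᵥ o) v := by
  rcases eq_or_ne v 0 with rfl | hv
  · simp only [(hF.isMinkowskiNorm _).map_zero]
    exact contDiff_const
  · exact contDiffOn_univ.1 ((hF.contDiffOn o).comp
      (contDiff_id.prodMk (contDiff_const (c := v))).contDiffOn fun _ _ => hv)

theorem IsMinkowskiNorm.isFinslerMetric_const {N : V → ℝ} (hN : IsMinkowskiNorm N)
    (hc : Continuous N) : IsFinslerMetric fun _ : P => N where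
  continuous := hc.comp continuous_snd
  contDiffOn _ := hN.contDiffOn.comp contDiff_snd.contDiffOn fun _ hq => hq
  isMinkowskiNorm _ := hN

/-- Freezing `F` at a base point `o` gives the invariant summand; equality of defects makes `F x - F
o` a linear form. -/
theorem IsFinslerMetric.isMinkowskiRanders [FiniteDimensional ℝ V] {F : P → V → ℝ}
    (hF : IsFinslerMetric F)
    (h : ∀ x y v w, additivityDefect (F x) v w = additivityDefect (F y) v w) :
    IsMinkowskiRanders F := by
  obtain ⟨o⟩ : Nonempty P := inferInstance
  refine ⟨hF, fun _ => F o, fun x => LinearMap.toContinuousLinearMap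
    ((hF.isMinkowskiNorm x).subLinear (hF.isMinkowskiNorm o) (h x o)),
    (hF.isMinkowskiNorm o).isFinslerMetric_const
      (hF.continuous.comp (continuous_const.prodMk continuous_id)), fun _ _ _ => rfl,
    fun p => contDiff_clm_apply_iff.2 fun v => ?_, fun x v => ?_⟩
  · exact (hF.contDiff_left p v).sub contDiff_const
  · simp [IsMinkowskiNorm.subLinear]

end Additivity

/-! ### Additivity from polarization -/

section Polarization

variable {V : Type*} [AddCommGroup V]

/-- A function satisfying the parallelogram law has a biadditive polarization. -/
theorem polar_add_right_of_parallelogram {q : V → ℝ}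
    (hq : ∀ u v, q (u + v) + q (u - v) = 2 * q u + 2 * q v) (u v w : V) :
    QuadraticMap.polar q u (v + w) = QuadraticMap.polar q u v + QuadraticMap.polar q u w := by
  have h₁ := hq (u + w) v
  have h₂ := hq u (w - v)
  have h₃ := hq (u + v) w
  have h₄ := hq w v
  rw [show u + w + v = u + (v + w) by abel, show u + w - v = u + (w - v) by abel] at h₁
  rw [show u - (w - v) = u + v - w by abel] at h₂
  rw [show u + v + w = u + (v + w) by abel] at h₃
  rw [show w + v = v + w by abel] at h₄
  simp only [QuadraticMap.polar]
  -- In `h₁ - h₂ + h₃` the terms at `u + (w - v)` and `u + v - w` cancel; `h₄` then eliminates `q (w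
  -- - v)`.
  linarith

/-- If `B` is additive in the first variable and `B u` is additive on pairs of vectors that lie
in a common plane with `u`, then `B` is additive in the second variable. -/
theorem add_right_of_add_on_planes {B : V →+ V → ℝ}
    (h₁ : ∀ u v, B u (u + v) = B u u + B u v) (h₂ : ∀ u v, B u (v + u) = B u v + B u u)
    (hneg : ∀ u v, B u (-v) = -B u v) (u v w : V) : B u (v + w) = B u v + B u w := by
  have hsub : ∀ u v, B u (u - v) = B u u - B u v := fun u v => by
    rw [sub_eq_add_neg, h₁, hneg, ← sub_eq_add_neg]
  have hsub' : ∀ u v, B v (u - v) = B v u - B v v := fun u v => by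
    rw [← neg_sub, hneg, hsub]
    ring
  have hpolar : ∀ u v, QuadraticMap.polar (fun z => B z z) u v = B u v + B v u := fun u v => by
    simp only [QuadraticMap.polar, map_add, Pi.add_apply, h₁, h₂]
    ring
  have hpar : ∀ u v, B (u + v) (u + v) + B (u - v) (u - v) = 2 * B u u + 2 * B v v := fun u v => by
    simp only [map_add, map_sub, Pi.add_apply, Pi.sub_apply, h₁, h₂, hsub, hsub']
    ring
  -- The terms with `u` in the second slot cancel by additivity in the first.
  have := polar_add_right_of_parallelogram (q := fun z => B z z) hpar u v w
  simp only [hpolar, map_add, Pi.add_apply] at this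
  linarith

end Polarization

/-! ### From planes to the whole space -/

section Planes

variable {V P : Type*} [NormedAddCommGroup V] [NormedSpace ℝ V]
  [MetricSpace P] [NormedAddTorsor V P]

/-- If the additivity defect of `F` is constant on every plane, it is constant. -/
theorem IsFinslerMetric.additivityDefect_eq_of_planes {F : P → V → ℝ} (hF : IsFinslerMetric F)
    (h : ∀ (x : P) (u e v w : V), v ∈ Submodule.span ℝ {u, e} → w ∈ Submodule.span ℝ {u, e} →
      additivityDefect (F (u +ᵥ x)) v w = additivityDefect (F x) v w)
    (x y : P) (v w : V) : additivityDefect (F x) v w = additivityDefect (F y) v w := by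
  have hd : ∀ (p : P) (v z : V), DifferentiableAt ℝ (fun w : V => F (w +ᵥ p) v) z :=
    fun p v z => (hF.contDiff_left p v).differentiable (by norm_num) z
  let B : P → V →+ V → ℝ := fun p =>
    { toFun := fun u v => fderiv ℝ (fun z : V => F (z +ᵥ p) v) 0 u
      map_zero' := by ext; simp
      map_add' := fun _ _ => by ext; simp }
  have hline : ∀ (p : P) (u v : V) (t : ℝ),
      HasDerivAt (fun s : ℝ => F (s • u +ᵥ p) v) (B (t • u +ᵥ p) u v) t := fun p u v t => by
    have h₁ : HasDerivAt (fun s : ℝ => (s - t) • u) u t := by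
      simpa using ((hasDerivAt_id t).sub_const t).smul_const u
    have h₂ := (hd (t • u +ᵥ p) v ((t - t) • u)).hasFDerivAt.comp_hasDerivAt t h₁
    rw [sub_self, zero_smul] at h₂
    refine h₂.congr_of_eventuallyEq (Filter.Eventually.of_forall fun s => ?_)
    simp only [Function.comp, vadd_vadd, ← add_smul, sub_add_cancel]
  have hdefect : ∀ (p : P) (u v w : V) (t : ℝ),
      HasDerivAt (fun s : ℝ => additivityDefect (F (s • u +ᵥ p)) v w)
        (B (t • u +ᵥ p) u (v + w) - B (t • u +ᵥ p) u v - B (t • u +ᵥ p) u w) t :=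
    fun p u v w t => ((hline p u (v + w) t).sub (hline p u v t)).sub (hline p u w t)
  have hplane : ∀ (p : P) (u e v w : V), v ∈ Submodule.span ℝ {u, e} →
      w ∈ Submodule.span ℝ {u, e} → B p u (v + w) = B p u v + B p u w := fun p u e v w hv hw => by
    have h₁ := hdefect p u v w 0
    have h₂ : (fun s : ℝ => additivityDefect (F (s • u +ᵥ p)) v w) =ᶠ[nhds 0]
        fun _ => additivityDefect (F p) v w := by
      filter_upwards with s
      rcases eq_or_ne s 0 with rfl | hs
      · simp
      -- For `s ≠ 0`, moving by `s • u` stays in the same plane, so `h` applies to it.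
      · have hspan : Submodule.span ℝ {u, e} ≤ Submodule.span ℝ {s • u, e} := by
          rw [Submodule.span_le]
          rintro z (rfl | rfl)
          · have := Submodule.smul_mem (Submodule.span ℝ {s • z, e}) s⁻¹
              (Submodule.subset_span (Set.mem_insert _ _))
            simpa [smul_smul, hs] using this
          · exact Submodule.subset_span (by simp)
        exact h p (s • u) e v w (hspan hv) (hspan hw)
    have h₃ := h₁.unique ((hasDerivAt_const 0 _).congr_of_eventuallyEq h₂)
    rw [zero_smul, zero_vadd] at h₃
    linarith
  have hu : ∀ u e : V, u ∈ Submodule.span ℝ {u, e} := fun u e => Submodule.subset_span (by simp)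
  have he : ∀ u e : V, e ∈ Submodule.span ℝ {u, e} := fun u e => Submodule.subset_span (by simp)
  have hadd : ∀ (p : P) (u v w : V), B p u (v + w) = B p u v + B p u w := fun p =>
    add_right_of_add_on_planes (fun u v => hplane p u v _ _ (hu u v) (he u v))
      (fun u v => hplane p u v _ _ (he u v) (hu u v)) fun u v => by
        have h₁ := hplane p u v v (-v) (he u v) (neg_mem (he u v))
        have h₂ : B p u 0 = 0 := by
          simp [B, (hF.isMinkowskiNorm _).map_zero]
        rw [add_neg_cancel, h₂] at h₁
        linarith
  have hconst := is_const_of_deriv_eq_zero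
    (f := fun s : ℝ => additivityDefect (F (s • (x -ᵥ y) +ᵥ y)) v w)
    (fun t => (hdefect y (x -ᵥ y) v w t).differentiableAt)
    (fun t => by rw [(hdefect y (x -ᵥ y) v w t).deriv, hadd]; ring) 1 0
  simpa using hconst

end Planes

/-! ### Closedness and density in the affine Grassmannian -/

section Grassmannian

variable {V P : Type*} [NormedAddCommGroup V] [NormedSpace ℝ V]
  [MetricSpace P] [NormedAddTorsor V P] {k : ℕ}

/-- The `k`-planes on which the additivity defect of `F` is constant. -/
def constantDefectPlanes (k : ℕ) (F : P → V → ℝ) : Set (Graff k V P) :=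
  {Y | ∀ x ∈ Y.1, ∀ y ∈ Y.1, ∀ v ∈ Y.1.direction, ∀ w ∈ Y.1.direction,
    additivityDefect (F x) v w = additivityDefect (F y) v w}

theorem mem_direction_span_iff (p : {p : Fin (k + 1) → P // AffineIndependent ℝ p}) (v : V) :
    v ∈ (Graff.span p).1.direction ↔
      ∃ a : Fin (k + 1) → ℝ, ∑ i, a i • (p.1 i -ᵥ p.1 0) = v := by
  rw [Graff.span, direction_affineSpan, vectorSpan_range_eq_span_range_vsub_right ℝ p.1 0,
    Submodule.mem_span_range_iff_exists_fun]

theorem mem_span_iff (p : {p : Fin (k + 1) → P // AffineIndependent ℝ p}) (x : P) :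
    x ∈ (Graff.span p).1 ↔
      ∃ a : Fin (k + 1) → ℝ, (∑ i, a i • (p.1 i -ᵥ p.1 0)) +ᵥ p.1 0 = x := by
  have h₀ : p.1 0 ∈ (Graff.span p).1 := mem_affineSpan ℝ (Set.mem_range_self 0)
  rw [← AffineSubspace.vsub_right_mem_direction_iff_mem h₀, mem_direction_span_iff]
  exact exists_congr fun a => by rw [eq_comm, eq_comm (b := x), eq_vadd_iff_vsub_eq]

/-- In the quotient topology, closedness is tested on affine frames. With coefficients fixed, points
and directions of the plane depend continuously on the frame, so the preimage is an intersection of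
equalizers of continuous functions. The coefficient of index `0` multiplies a zero vector and is
harmless. -/
theorem IsFinslerMetric.isClosed_constantDefectPlanes {F : P → V → ℝ} (hF : IsFinslerMetric F) :
    IsClosed (constantDefectPlanes k F) := by
  refine isClosed_coinduced.2 ?_
  have hpre : Graff.span ⁻¹' constantDefectPlanes k F =
      ⋂ (a : Fin (k + 1) → ℝ) (b : Fin (k + 1) → ℝ) (c : Fin (k + 1) → ℝ) (d : Fin (k + 1) → ℝ),
        {p | additivityDefect (F ((∑ i, a i • (p.1 i -ᵥ p.1 0)) +ᵥ p.1 0))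
            (∑ i, c i • (p.1 i -ᵥ p.1 0)) (∑ i, d i • (p.1 i -ᵥ p.1 0)) =
          additivityDefect (F ((∑ i, b i • (p.1 i -ᵥ p.1 0)) +ᵥ p.1 0))
            (∑ i, c i • (p.1 i -ᵥ p.1 0)) (∑ i, d i • (p.1 i -ᵥ p.1 0))} := by
    ext p
    simp only [constantDefectPlanes, Set.mem_preimage, Set.mem_ofPred_eq, mem_span_iff,
      mem_direction_span_iff, Set.mem_iInter, forall_exists_index, forall_apply_eq_imp_iff]
  rw [hpre]
  have hpt : ∀ i, Continuous fun p : {p : Fin (k + 1) → P // AffineIndependent ℝ p} => p.1 i :=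
    fun i => (continuous_apply i).comp continuous_subtype_val
  have hvec : ∀ a : Fin (k + 1) → ℝ, Continuous
      fun p : {p : Fin (k + 1) → P // AffineIndependent ℝ p} => ∑ i, a i • (p.1 i -ᵥ p.1 0) :=
    fun a => continuous_finsetSum _ fun i _ => ((hpt i).vsub (hpt 0)).const_smul (a i)
  have hval : ∀ {x : {p : Fin (k + 1) → P // AffineIndependent ℝ p} → P}
      {v : {p : Fin (k + 1) → P // AffineIndependent ℝ p} → V}, Continuous x → Continuous v →
      Continuous fun p => F (x p) (v p) := fun hx hv => hF.continuous.comp (hx.prodMk hv)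
  have hdef : ∀ a c d : Fin (k + 1) → ℝ, Continuous
      fun p : {p : Fin (k + 1) → P // AffineIndependent ℝ p} =>
        additivityDefect (F ((∑ i, a i • (p.1 i -ᵥ p.1 0)) +ᵥ p.1 0))
            (∑ i, c i • (p.1 i -ᵥ p.1 0)) (∑ i, d i • (p.1 i -ᵥ p.1 0)) := fun a c d =>
    ((hval ((hvec a).vadd (hpt 0)) ((hvec c).add (hvec d))).sub
      (hval ((hvec a).vadd (hpt 0)) (hvec c))).sub (hval ((hvec a).vadd (hpt 0)) (hvec d))
  exact isClosed_iInter fun a => isClosed_iInter fun b => isClosed_iInter fun c =>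
    isClosed_iInter fun d => isClosed_eq (hdef a c d) (hdef b c d)

theorem setOf_isMinkowskiRanders_subset (F : P → V → ℝ) :
    {Y : Graff k V P | IsMinkowskiRanders (inducedMetric F Y.1)} ⊆ constantDefectPlanes k F :=
  fun _ hY x hx y hy v hv w hw => hY.additivityDefect_eq ⟨x, hx⟩ ⟨y, hy⟩ ⟨v, hv⟩ ⟨w, hw⟩

theorem Submodule.exists_le_finrank_eq [FiniteDimensional ℝ V] (S : Submodule ℝ V)
    (hS : finrank ℝ S ≤ k) (hk : k ≤ finrank ℝ V) :
    ∃ W : Submodule ℝ V, S ≤ W ∧ finrank ℝ W = k := by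
  induction k, hS using Nat.le_induction with
  | base => exact ⟨S, le_rfl, rfl⟩
  | succ j _ ih =>
    obtain ⟨W, hSW, hW⟩ := ih (by omega)
    obtain ⟨v, hv⟩ : ∃ v, v ∉ W := by
      by_contra! h
      have : finrank ℝ W = finrank ℝ V := by
        rw [(Submodule.eq_top_iff'.2 h : W = ⊤), finrank_top]
      omega
    have hv₀ : v ≠ 0 := fun h => hv (h ▸ W.zero_mem)
    have hinf : W ⊓ ℝ ∙ v = ⊥ := ((Submodule.disjoint_span_singleton' hv₀).2 hv).eq_bot
    have hsum := Submodule.finrank_sup_add_finrank_inf_eq W (ℝ ∙ v)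
    rw [hinf, finrank_bot, finrank_span_singleton hv₀] at hsum
    exact ⟨W ⊔ ℝ ∙ v, hSW.trans le_sup_left, by omega⟩

/-- Through every point there is a `k`-plane whose direction contains two given vectors. -/
theorem Graff.exists_mem_direction [FiniteDimensional ℝ V] (hk : 2 ≤ k)
    (hkn : k ≤ finrank ℝ V) (x : P) (u e : V) :
    ∃ Y : Graff k V P, x ∈ Y.1 ∧ Submodule.span ℝ {u, e} ≤ Y.1.direction := by
  have hle : finrank ℝ (Submodule.span ℝ {u, e}) ≤ k := by
    classical
    refine le_trans ?_ hk
    have := (finrank_span_finset_le_card (R := ℝ) ({u, e} : Finset V)).trans Finset.card_le_two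
    rwa [Set.finrank, Finset.coe_pair] at this
  obtain ⟨W, hW, hWk⟩ := Submodule.exists_le_finrank_eq _ hle hkn
  exact ⟨⟨AffineSubspace.mk' x W, ⟨x, AffineSubspace.self_mem_mk' x W⟩, by
    rw [AffineSubspace.direction_mk', hWk]⟩, AffineSubspace.self_mem_mk' x W, by
    rwa [AffineSubspace.direction_mk']⟩

end Grassmannian

theorem mainTheorem7 {V P : Type*} [NormedAddCommGroup V] [NormedSpace ℝ V]
    [FiniteDimensional ℝ V] [MetricSpace P] [NormedAddTorsor V P]
    (n : ℕ) (hn : Module.finrank ℝ V = n) (hn3 : 3 ≤ n)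
    (F : P → V → ℝ) (hF : IsFinslerMetric F) :
    IsMinkowskiRanders F ↔
      ∃ k : ℕ, 2 ≤ k ∧ k ≤ n - 1 ∧
        Dense {Y : Graff k V P | IsMinkowskiRanders (inducedMetric F Y.1)} := by
  constructor
  · intro h
    -- Any admissible `k` would do; `k = 2` is admissible because `n ≥ 3`.
    refine ⟨2, le_rfl, by omega, ?_⟩
    rw [Set.eq_univ_of_forall (s := {Y : Graff 2 V P | IsMinkowskiRanders (inducedMetric F Y.1)})
      fun Y => h.inducedMetric Y.1]
    exact dense_univ
  · rintro ⟨k, hk, hkn, hdense⟩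
    have huniv : constantDefectPlanes k F = Set.univ :=
      hF.isClosed_constantDefectPlanes.closure_eq.symm.trans
        (hdense.mono (setOf_isMinkowskiRanders_subset F)).closure_eq
    refine hF.isMinkowskiRanders (hF.additivityDefect_eq_of_planes fun x u e v w hv hw => ?_)
    obtain ⟨Y, hx, hY⟩ := Graff.exists_mem_direction hk (by omega : k ≤ finrank ℝ V) x u e
    have hmem : Y ∈ constantDefectPlanes k F := huniv ▸ Set.mem_univ Y
    exact hmem _ (AffineSubspace.vadd_mem_of_mem_direction
      (hY (Submodule.subset_span (by simp))) hx) _ hx _ (hY hv) _ (hY hw)
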